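/- Let $\mathrm{sign}(t)=+1$ for $t\ge 0$ and $\mathrm{sign}(t)=-1$ for $t<0$. For an odd prime $p$ and a generator $g$ of $\mathbb{Z}_p^*=(\mathbb{Z}/p)^\times$ let $\log_g(x)\in\{0,\dots,p-2\}$ be the discrete logarithm of $x\in\mathbb{Z}_p^*$, and put $z(x)=\log_g(x)/p\in[0,1)$. For $s\in\mathbb{N}$ (only $s$ modulo $p-1$ matters), the discrete-logarithm learning problem has the label $y(x)=+1$ if $\log_g(x)$ is congruent modulo $p-1$ to one of $s,s+1,\dots,s+\frac{p-3}{2}$, and $y(x)=-1$ otherwise; inputs $x$ are drawn uniformly from $\mathbb{Z}_p^*$. The projected quantum kernel is $$k^{\mathrm{PQ}}(x,x')=\bigl((\log_g x/p)(\log_g x'/p)+1\bigr)^2 ,$$ and $\mathcal{H}=\{z\mapsto\mathrm{sign}(az^2+bz+c) : a,b,c\in\mathbb{R}\}$. Then the following hold. 1. The VC dimension of $\mathcal{H}$, as a class of functions on $\mathbb{R}$, is $3$. 2. For all $p$, $g$, $s$ as above: (a) there is $h\in\mathcal{H}$ with $y(x)=h(z(x))$ for all $x\in\mathbb{Z}_p^*$;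 (b) the functions $x\mapsto\sum_{i=1}^M\alpha_i k^{\mathrm{PQ}}(u_i,x)+\beta$ on $\mathbb{Z}_p^*$ (with $M\in\mathbb{N}$, $u_i\in\mathbb{Z}_p^*$, $\alpha_i,\beta\in\mathbb{R}$) are exactly the functions $x\mapsto a\,z(x)^2+b\,z(x)+c$ with $a,b,c\in\mathbb{R}$; (c) every training set can be fitted perfectly with this kernel: for all $N$ and $x_1,\dots,x_N\in\mathbb{Z}_p^*$ there are $\alpha_1,\dots,\alpha_N\in\mathbb{R}$ with $y(x_j)\sum_{i=1}^N\alpha_i k^{\mathrm{PQ}}(x_i,x_j)\ge 1$ for all $j$. 3. There is an absolute constant $C>0$, independent of $p$, $g$, $s$ (hence of the input size $n=\lceil\log_2 p\rceil$), such that for all $p$, $g$, $s$ as above, every $0<\epsilon\le 1/2$ and every $N\ge C\log(1/\epsilon)/\epsilon^2$: with probability at least $0.99$ over independent uniform samples $x_1,\dots,x_N$ from $\mathbb{Z}_p^*$, every $h_*\in\mathcal{H}$ that fits the training data perfectly, i.e. $h_*(z(x_i))=y(x_i)$ for $i=1,\dots,N$, satisfies $$\mathbb{P}_{x\sim\mathbb{Z}_p^*}\bigl[h_*(z(x))\neq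 y(x)\bigr]\le\epsilon .$$ -/

import Mathlib

noncomputable section

/-- The sign function with values in `{+1, -1}` and the convention `sgn 0 = +1`. -/
def sgn (t : ℝ) : ℤˣ := if 0 ≤ t then 1 else -1

/-- The class `{z ↦ sgn (a z² + b z + c) | a, b, c ∈ ℝ}` of signs of quadratics. -/
def quadSignClass : Set (ℝ → ℤˣ) :=
  {h | ∃ a b c : ℝ, h = fun z => sgn (a * z ^ 2 + b * z + c)}

/-- A class `H` of `{+1, -1}`-valued functions shatters the finite set `S` if every labelling of
`S` is realized by a member of `H`. -/
def ClassShatters {X : Type*} (H : Set (X → ℤˣ)) (S : Finset X) : Prop :=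
  ∀ l : X → ℤˣ, ∃ h ∈ H, ∀ x ∈ S, h x = l x

/-- The VC dimension of a class of `{+1, -1}`-valued functions: the supremum of the cardinalities
of the finite sets it shatters. -/
def classVCDim {X : Type*} (H : Set (X → ℤˣ)) : ℕ∞ :=
  ⨆ S : {S : Finset X // ClassShatters H S}, (S.1.card : ℕ∞)

/-- The probability of an event under the uniform distribution on a finite nonempty type.
For the type `Fin N → X` this is the law of `N` independent uniform samples from `X`. -/
def unifProb {Ω : Type*} [Fintype Ω] [Nonempty Ω] (E : Set Ω) : ℝ :=
  ((PMF.uniformOfFintype Ω).toOuterMeasure E).toReal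

/-- The discrete logarithm to base `g`: the least `k` with `g ^ k = x`. For a generator `g` of the
multiplicative group of `ZMod p` it takes exactly the values `0, …, p - 2`. -/
def dlog {p : ℕ} (g x : (ZMod p)ˣ) : ℕ := sInf {k : ℕ | g ^ k = x}

/-- The label of `x`: it is `+1` if the discrete logarithm of `x` lies in the interval
`[s, s + (p - 3) / 2]` of exponents, read cyclically modulo the order `p - 1` of the group, and
`-1` otherwise. -/
def dlogLabel {p : ℕ} (g : (ZMod p)ˣ) (s : ℕ) (x : (ZMod p)ˣ) : ℤˣ :=
  open Classical in
  if ∃ k : ℕ, k ≤ (p - 3) / 2 ∧ dlog g x ≡ s + k [MOD (p - 1)] then 1 else -1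

/-- The projected feature `z = log_g(x) / p`, a real number in `[0, 1)`. -/
def projFeature {p : ℕ} (g x : (ZMod p)ˣ) : ℝ := (dlog g x : ℝ) / (p : ℝ)

/-- The projected quantum kernel `((log_g x / p) (log_g x' / p) + 1)²`. -/
def projKernel {p : ℕ} (g x x' : (ZMod p)ˣ) : ℝ :=
  (projFeature g x * projFeature g x' + 1) ^ 2

/-- The real-valued output at `x` of the kernel machine for the projected quantum kernel with
centers `u`, coefficients `α` and bias `β`; it predicts the label `sgn` of this number. -/
def kernelScore {p : ℕ} (g : (ZMod p)ˣ) {N : ℕ} (u : Fin N → (ZMod p)ˣ) (α : Fin N → ℝ) (β : ℝ)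
    (x : (ZMod p)ˣ) : ℝ :=
  (∑ i, α i * projKernel g (u i) x) + β

end

/-! Everything reduces to real quadratics in the exponent. The VC bound holds because a quadratic
cannot alternate in sign at four points (`quadratic_alternation`). A cyclic half-interval of
exponents is an interval or the complement of one, so the labels are strict signs of a quadratic
(`exists_half_interval`). The kernel is an inner product of features spanning the quadratics, and
projecting onto the training features gives the fit with margin.

The sample bound uses no general VC theorem. Cut the exponents into blocks of length L, about εp/5.
With high probability every full block is sampled (`unifProb_hit_blocks`, by a union bound). A
consistent hypothesis agrees with the label somewhere in each full block, so it can err there only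
if the block contains one of at most four roots. Adding the incomplete last block, the errors lie in
at most five blocks (`card_disagreement_le`). -/

theorem sgn_eq_one_iff {t : ℝ} : sgn t = 1 ↔ 0 ≤ t := by
  unfold sgn; split_ifs with h <;> simp [h]

theorem sgn_eq_neg_one_iff {t : ℝ} : sgn t = -1 ↔ t < 0 := by
  unfold sgn
  split_ifs with h
  · simpa using h
  · simpa using h

theorem unifProb_eq {Ω : Type*} [Fintype Ω] [Nonempty Ω] (E : Set Ω) [DecidablePred (· ∈ E)] :
    unifProb E = ((Finset.univ.filter (· ∈ E)).card : ℝ) / (Fintype.card Ω : ℝ) := by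
  unfold unifProb
  rw [PMF.toOuterMeasure_uniformOfFintype_apply, ENNReal.toReal_div, ENNReal.toReal_natCast,
    ENNReal.toReal_natCast, Fintype.card_subtype]

/-! ### The VC dimension of signs of quadratics -/

/-- The third divided difference of a quadratic vanishes, and its weights, after clearing
denominators, alternate in sign. -/
theorem quadratic_alternation {a b c w x y z : ℝ} (hwx : w < x) (hxy : x < y) (hyz : y < z)
    (h0 : 0 ≤ a * w ^ 2 + b * w + c) (h1 : a * x ^ 2 + b * x + c < 0)
    (h2 : 0 ≤ a * y ^ 2 + b * y + c) (h3 : a * z ^ 2 + b * z + c < 0) : False := by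
  have hxw := sub_pos.2 hwx
  have hyx := sub_pos.2 hxy
  have hzy := sub_pos.2 hyz
  have hyw := sub_pos.2 (hwx.trans hxy)
  have hzx := sub_pos.2 (hxy.trans hyz)
  have hzw := sub_pos.2 ((hwx.trans hxy).trans hyz)
  have t0 := mul_nonneg (by positivity : 0 ≤ (y - x) * (z - x) * (z - y)) h0
  have t1 := mul_pos (by positivity : 0 < (y - w) * (z - w) * (z - y)) (neg_pos.2 h1)
  have t2 := mul_nonneg (by positivity : 0 ≤ (x - w) * (z - w) * (z - x)) h2
  have t3 := mul_pos (by positivity : 0 < (x - w) * (y - w) * (y - x)) (neg_pos.2 h3)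
  have key : (y - x) * (z - x) * (z - y) * (a * w ^ 2 + b * w + c)
      + (y - w) * (z - w) * (z - y) * -(a * x ^ 2 + b * x + c)
      + (x - w) * (z - w) * (z - x) * (a * y ^ 2 + b * y + c)
      + (x - w) * (y - w) * (y - x) * -(a * z ^ 2 + b * z + c) = 0 := by ring
  linarith

theorem card_le_three_of_shatters {S : Finset ℝ} (hS : ClassShatters quadSignClass S) :
    S.card ≤ 3 := by
  by_contra! hcard
  obtain ⟨T, hTS, hT⟩ := Finset.exists_subset_card_eq (show 4 ≤ S.card from hcard)
  set e := T.orderEmbOfFin hT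
  have hmem (i : Fin 4) : e i ∈ S := hTS (T.orderEmbOfFin_mem hT i)
  obtain ⟨h, ⟨a, b, c, rfl⟩, hl⟩ := hS fun t => if t = e 0 ∨ t = e 2 then 1 else -1
  have h01 : e 0 < e 1 := e.strictMono (by decide)
  have h12 : e 1 < e 2 := e.strictMono (by decide)
  have h23 : e 2 < e 3 := e.strictMono (by decide)
  refine quadratic_alternation (a := a) (b := b) (c := c) h01 h12 h23 ?_ ?_ ?_ ?_
  · exact sgn_eq_one_iff.1 (by simpa using hl _ (hmem 0))
  · exact sgn_eq_neg_one_iff.1 (by simpa [h01.ne', h12.ne] using hl _ (hmem 1))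
  · exact sgn_eq_one_iff.1 (by simpa using hl _ (hmem 2))
  · exact sgn_eq_neg_one_iff.1
      (by simpa [(h01.trans (h12.trans h23)).ne', h23.ne'] using hl _ (hmem 3))

theorem sgn_intCast_units (e : ℤˣ) : sgn ((e : ℤ) : ℝ) = e := by
  rcases Int.units_eq_one_or e with rfl | rfl
  · exact sgn_eq_one_iff.2 (by norm_num)
  · exact sgn_eq_neg_one_iff.2 (by norm_num)

theorem shatters_zero_one_two : ClassShatters quadSignClass ({0, 1, 2} : Finset ℝ) := by
  intro l
  set A : ℝ := ((l 0 : ℤ) : ℝ) with hA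
  set B : ℝ := ((l 1 : ℤ) : ℝ) with hB
  set D : ℝ := ((l 2 : ℤ) : ℝ) with hD
  -- Lagrange interpolation of the three labels at 0, 1, 2.
  refine ⟨_, ⟨(A - 2 * B + D) / 2, (-3 * A + 4 * B - D) / 2, A, rfl⟩, ?_⟩
  intro x hx
  simp only [Finset.mem_insert, Finset.mem_singleton] at hx
  rcases hx with rfl | rfl | rfl
  · rw [← sgn_intCast_units (l 0), ← hA]; congr 1; ring
  · rw [← sgn_intCast_units (l 1), ← hB]; congr 1; ring
  · rw [← sgn_intCast_units (l 2), ← hD]; congr 1; ring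

theorem classVCDim_quadSignClass : classVCDim quadSignClass = 3 := by
  apply le_antisymm
  · refine iSup_le fun S => ?_
    exact_mod_cast card_le_three_of_shatters S.2
  · have h := le_iSup (fun S : {S : Finset ℝ // ClassShatters quadSignClass S} =>
      (S.1.card : ℕ∞)) ⟨_, shatters_zero_one_two⟩
    have hc : ({0, 1, 2} : Finset ℝ).card = 3 := by
      rw [Finset.card_eq_three]
      exact ⟨0, 1, 2, by norm_num, by norm_num, by norm_num, rfl⟩
    rw [classVCDim]
    simpa only [hc, Nat.cast_ofNat] using h

/-! ### Discrete logarithms -/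

section DiscreteLog

variable {p : ℕ} [Fact p.Prime] {g : (ZMod p)ˣ}

theorem orderOf_generator (hg : ∀ x : (ZMod p)ˣ, x ∈ Subgroup.zpowers g) :
    orderOf g = p - 1 := by
  rw [orderOf_eq_card_of_forall_mem_zpowers hg, Nat.card_eq_fintype_card, ZMod.card_units]

theorem pow_dlog (hg : ∀ x : (ZMod p)ˣ, x ∈ Subgroup.zpowers g) (x : (ZMod p)ˣ) :
    g ^ dlog g x = x := by
  obtain ⟨k, hk⟩ := mem_powers_iff_mem_zpowers.2 (hg x)
  exact Nat.sInf_mem (s := {k : ℕ | g ^ k = x}) ⟨k, hk⟩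

theorem dlog_lt (hg : ∀ x : (ZMod p)ˣ, x ∈ Subgroup.zpowers g) (x : (ZMod p)ˣ) :
    dlog g x < p - 1 := by
  rw [← orderOf_generator hg]
  have h : dlog g x ≤ dlog g x % orderOf g :=
    Nat.sInf_le (show g ^ (dlog g x % orderOf g) = x by rw [pow_mod_orderOf, pow_dlog hg])
  exact h.trans_lt (Nat.mod_lt _ (orderOf_pos g))

theorem dlog_pow (hg : ∀ x : (ZMod p)ˣ, x ∈ Subgroup.zpowers g) {k : ℕ} (hk : k < p - 1) :
    dlog g (g ^ k) = k := by
  have h := pow_dlog hg (g ^ k)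
  have hlt := dlog_lt hg (g ^ k)
  rw [← orderOf_generator hg] at hk hlt
  exact pow_injOn_Iio_orderOf hlt hk h

theorem dlog_injective (hg : ∀ x : (ZMod p)ˣ, x ∈ Subgroup.zpowers g) :
    Function.Injective (dlog g) := fun x y h => by
  rw [← pow_dlog hg x, h, pow_dlog hg]

theorem card_filter_dlog (hg : ∀ x : (ZMod p)ˣ, x ∈ Subgroup.zpowers g) (P : ℕ → Prop)
    [DecidablePred P] :
    (Finset.univ.filter fun x : (ZMod p)ˣ => P (dlog g x)).card
      = ((Finset.range (p - 1)).filter P).card := by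
  refine Finset.card_bij (fun x _ => dlog g x) ?_ ?_ ?_
  · intro x hx
    simp only [Finset.mem_filter, Finset.mem_univ, true_and] at hx
    simp [dlog_lt hg x, hx]
  · intro x _ y _ h
    exact dlog_injective hg h
  · intro k hk
    simp only [Finset.mem_filter, Finset.mem_range] at hk
    exact ⟨g ^ k, by simpa [dlog_pow hg hk.1] using hk.2, dlog_pow hg hk.1⟩

theorem prime_cast_pos : (0 : ℝ) < p := by exact_mod_cast (Fact.out : p.Prime).pos

/-! ### Labels as signs of quadratics -/

theorem dlogLabel_eq_one_iff {s : ℕ} {x : (ZMod p)ˣ} :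
    dlogLabel g s x = 1 ↔ ∃ k : ℕ, k ≤ (p - 3) / 2 ∧ dlog g x ≡ s + k [MOD (p - 1)] := by
  unfold dlogLabel
  split_ifs with h <;> simp [h]

/-- With r = s mod 2m, the half-interval wraps around exactly when r > m. The quadratic has
half-integer roots at the interval's ends, or at the ends of its complement, so it vanishes at no
exponent; this strictness later yields the margin. -/
theorem exists_half_interval {m : ℕ} (hm : 0 < m) (s : ℕ) :
    ∃ A B C : ℝ, ∀ k < 2 * m,
      ((∃ i ≤ m - 1, k ≡ s + i [MOD 2 * m]) → 0 < A * (k : ℝ) ^ 2 + B * k + C) ∧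
      ((¬ ∃ i ≤ m - 1, k ≡ s + i [MOD 2 * m]) → A * (k : ℝ) ^ 2 + B * k + C < 0) := by
  obtain ⟨r, hr, hsr⟩ : ∃ r < 2 * m, s ≡ r [MOD 2 * m] :=
    ⟨s % (2 * m), Nat.mod_lt _ (by omega), (Nat.mod_modEq _ _).symm⟩
  have hiff (k : ℕ) (hk : k < 2 * m) : (∃ i ≤ m - 1, k ≡ s + i [MOD 2 * m]) ↔
      (r ≤ k ∧ k < r + m) ∨ k + m < r := by
    constructor
    · rintro ⟨i, hi, h⟩
      have h' : k ≡ r + i [MOD 2 * m] := h.trans (hsr.add_right i)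
      rw [Nat.ModEq, Nat.mod_eq_of_lt hk] at h'
      rcases lt_or_ge (r + i) (2 * m) with hlt | hge
      · rw [Nat.mod_eq_of_lt hlt] at h'; omega
      · rw [Nat.mod_eq_sub_mod hge, Nat.mod_eq_of_lt (by omega)] at h'; omega
    · rintro (⟨h1, h2⟩ | h)
      · refine ⟨k - r, by omega, ?_⟩
        have := hsr.add_right (k - r)
        rw [Nat.add_sub_cancel' h1] at this
        exact this.symm
      · refine ⟨k + 2 * m - r, by omega, ?_⟩
        have := hsr.add_right (k + 2 * m - r)
        rw [show r + (k + 2 * m - r) = k + 2 * m by omega] at this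
        exact (this.trans (by simp [Nat.ModEq])).symm
  rcases le_or_gt r m with hrm | hrm
  · refine ⟨-1, (r - 1 / 2) + (r + m - 1 / 2), -((r - 1 / 2) * (r + m - 1 / 2)), fun k hk => ?_⟩
    rw [hiff k hk, show (-1 : ℝ) * (k : ℝ) ^ 2 + ((r - 1 / 2) + (r + m - 1 / 2)) * k
      + -((r - 1 / 2) * (r + m - 1 / 2)) = (k - (r - 1 / 2)) * ((r + m - 1 / 2) - k) by ring]
    constructor
    · intro h
      have h1 : (r : ℝ) ≤ k := by exact_mod_cast (by omega : r ≤ k)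
      have h2 : (k : ℝ) + 1 ≤ r + m := by exact_mod_cast (by omega : k + 1 ≤ r + m)
      exact mul_pos (by linarith) (by linarith)
    · intro h
      rcases (by omega : k + 1 ≤ r ∨ r + m ≤ k) with h | h
      · have h1 : (k : ℝ) + 1 ≤ r := by exact_mod_cast h
        have h2 : (0 : ℝ) ≤ m := by positivity
        exact mul_neg_of_neg_of_pos (by linarith) (by linarith)
      · have h1 : (r : ℝ) + m ≤ k := by exact_mod_cast h
        have h2 : (1 : ℝ) ≤ m := by exact_mod_cast hm
        exact mul_neg_of_pos_of_neg (by linarith) (by linarith)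
  · refine ⟨1, -((r - m - 1 / 2) + (r - 1 / 2)), (r - m - 1 / 2) * (r - 1 / 2), fun k hk => ?_⟩
    rw [hiff k hk, show (1 : ℝ) * (k : ℝ) ^ 2 + -((r - m - 1 / 2) + (r - 1 / 2)) * k
      + (r - m - 1 / 2) * (r - 1 / 2) = (k - (r - m - 1 / 2)) * (k - (r - 1 / 2)) by ring]
    have h0 : (1 : ℝ) ≤ m := by exact_mod_cast hm
    constructor
    · intro h
      rcases (by omega : r ≤ k ∨ k + m + 1 ≤ r) with h | h
      · have h1 : (r : ℝ) ≤ k := by exact_mod_cast h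
        exact mul_pos (by linarith) (by linarith)
      · have h1 : (k : ℝ) + m + 1 ≤ r := by exact_mod_cast h
        exact mul_pos_of_neg_of_neg (by linarith) (by linarith)
    · intro h
      have h1 : (k : ℝ) + 1 ≤ r := by exact_mod_cast (by omega : k + 1 ≤ r)
      have h2 : (r : ℝ) ≤ k + m := by exact_mod_cast (by omega : r ≤ k + m)
      exact mul_neg_of_pos_of_neg (by linarith) (by linarith)

theorem exists_quadratic_label_mul_pos (hp : p ≠ 2)
    (hg : ∀ x : (ZMod p)ˣ, x ∈ Subgroup.zpowers g) (s : ℕ) :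
    ∃ a b c : ℝ, ∀ x : (ZMod p)ˣ, 0 < (((dlogLabel g s x : ℤˣ) : ℤ) : ℝ) *
      (a * projFeature g x ^ 2 + b * projFeature g x + c) := by
  obtain ⟨m, hm⟩ := (Fact.out : p.Prime).even_sub_one hp
  have h2 : 2 ≤ p := (Fact.out : p.Prime).two_le
  have e1 : m - 1 = (p - 3) / 2 := by omega
  have e2 : 2 * m = p - 1 := by omega
  obtain ⟨A, B, C, h⟩ := exists_half_interval (m := m) (by omega) s
  have hp0 := (prime_cast_pos (p := p)).ne'
  refine ⟨A * p ^ 2, B * p, C, fun x => ?_⟩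
  have hq : A * p ^ 2 * projFeature g x ^ 2 + B * p * projFeature g x + C
      = A * (dlog g x : ℝ) ^ 2 + B * dlog g x + C := by
    unfold projFeature; field_simp
  have hx := h (dlog g x) (e2 ▸ dlog_lt hg x)
  rw [hq]
  rw [e1, e2] at hx
  by_cases hc : ∃ k : ℕ, k ≤ (p - 3) / 2 ∧ dlog g x ≡ s + k [MOD (p - 1)]
  · rw [dlogLabel_eq_one_iff.2 hc]
    simpa using hx.1 hc
  · rw [(Int.units_eq_one_or _).resolve_left (mt dlogLabel_eq_one_iff.1 hc)]
    have := hx.2 hc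
    push_cast
    linarith

theorem sgn_eq_of_mul_pos {e : ℤˣ} {t : ℝ} (h : 0 < ((e : ℤ) : ℝ) * t) : e = sgn t := by
  rcases Int.units_eq_one_or e with rfl | rfl
  · exact (sgn_eq_one_iff.2 (by simpa using h.le)).symm
  · exact (sgn_eq_neg_one_iff.2 (by simpa using h)).symm

theorem exists_quadSignClass_eq_dlogLabel (hp : p ≠ 2)
    (hg : ∀ x : (ZMod p)ˣ, x ∈ Subgroup.zpowers g) (s : ℕ) :
    ∃ h ∈ quadSignClass, ∀ x : (ZMod p)ˣ, dlogLabel g s x = h (projFeature g x) := by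
  obtain ⟨a, b, c, h⟩ := exists_quadratic_label_mul_pos hp hg s
  exact ⟨_, ⟨a, b, c, rfl⟩, fun x => sgn_eq_of_mul_pos (h x)⟩

/-! ### Functions expressed by the projected quantum kernel -/

theorem kernelScore_eq_quadratic {N : ℕ} (u : Fin N → (ZMod p)ˣ) (α : Fin N → ℝ) (β : ℝ)
    (x : (ZMod p)ˣ) :
    kernelScore g u α β x = (∑ i, α i * projFeature g (u i) ^ 2) * projFeature g x ^ 2
      + (∑ i, 2 * α i * projFeature g (u i)) * projFeature g x + (∑ i, α i + β) := by
  unfold kernelScore projKernel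
  rw [Finset.sum_mul, Finset.sum_mul, ← add_assoc, ← Finset.sum_add_distrib,
    ← Finset.sum_add_distrib]
  congr 1
  exact Finset.sum_congr rfl fun i _ => by ring

theorem projFeature_pow (hg : ∀ x : (ZMod p)ˣ, x ∈ Subgroup.zpowers g) {k : ℕ}
    (hk : k < p - 1) : projFeature g (g ^ k) = k / p := by
  rw [projFeature, dlog_pow hg hk]

theorem kernel_functions_eq_quadratics (hp : p ≠ 2)
    (hg : ∀ x : (ZMod p)ˣ, x ∈ Subgroup.zpowers g) :
    {f : (ZMod p)ˣ → ℝ | ∃ (M : ℕ) (u : Fin M → (ZMod p)ˣ) (α : Fin M → ℝ) (β : ℝ),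
        f = kernelScore g u α β} =
      {f : (ZMod p)ˣ → ℝ | ∃ a b c : ℝ,
        f = fun x => a * projFeature g x ^ 2 + b * projFeature g x + c} := by
  have h2 : 2 ≤ p := (Fact.out : p.Prime).two_le
  have hp0 := (prime_cast_pos (p := p)).ne'
  ext f
  simp only [Set.mem_ofPred_eq]
  constructor
  · rintro ⟨M, u, α, β, rfl⟩
    exact ⟨_, _, _, funext fun x => kernelScore_eq_quadratic u α β x⟩
  · rintro ⟨a, b, c, rfl⟩
    -- For p = 3 the feature takes only the values 0 and 1/3, so matching two values suffices. One
    -- center at 1/3 does it: its kernel values there differ by (10/9)² - 1 = 19/81.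
    rcases eq_or_ne p 3 with h3 | h3
    · have h3' : (p : ℝ) = 3 := by exact_mod_cast h3
      refine ⟨1, ![g ^ 1], ![(a / 9 + b / 3) * (81 / 19)],
        c - (a / 9 + b / 3) * (81 / 19), funext fun x => ?_⟩
      have hz := projFeature_pow hg (k := 1) (by omega)
      rw [kernelScore_eq_quadratic]
      simp only [Finset.univ_unique, Finset.sum_singleton, Matrix.cons_val_fin_one, hz]
      have hx := dlog_lt hg x
      rw [projFeature, h3']
      obtain hd | hd : dlog g x = 0 ∨ dlog g x = 1 := by omega
      · rw [hd]; push_cast; ring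
      · rw [hd]; push_cast; ring
    · have hq : 2 < p - 1 := by
        obtain ⟨m, hm⟩ := (Fact.out : p.Prime).even_sub_one hp
        omega
      -- The weights solve r + 4t = ap² and 2(r + 2t) = bp, matching the two leading coefficients
      -- for centers at exponents 1 and 2; the bias absorbs the constant.
      set t : ℝ := a * p ^ 2 / 2 - b * p / 4 with ht
      set r : ℝ := b * p - a * p ^ 2 with hr
      refine ⟨2, ![g ^ 1, g ^ 2], ![r, t], c - (r + t), funext fun x => ?_⟩
      rw [kernelScore_eq_quadratic]
      simp only [Fin.sum_univ_two, Matrix.cons_val_zero, Matrix.cons_val_one,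
        projFeature_pow hg (k := 1) (by omega), projFeature_pow hg (k := 2) hq, ht, hr]
      push_cast
      field_simp
      ring

/-- The feature map of the quadratic kernel. -/
noncomputable def quadFeature (z : ℝ) : EuclideanSpace ℝ (Fin 3) := !₂[z ^ 2, √2 * z, 1]

theorem inner_quadFeature (z w : ℝ) :
    inner ℝ (quadFeature z) (quadFeature w) = (z * w + 1) ^ 2 := by
  have h : √2 * √2 = (2 : ℝ) := Real.mul_self_sqrt (by norm_num)
  simp only [quadFeature, PiLp.inner_apply, Fin.sum_univ_three]
  simp
  linear_combination (z * w) * h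

theorem inner_toLp_quadFeature (a b c z : ℝ) :
    inner ℝ (!₂[a, b / √2, c] : EuclideanSpace ℝ (Fin 3)) (quadFeature z)
      = a * z ^ 2 + b * z + c := by
  have h : √2 ≠ (0 : ℝ) := by positivity
  simp only [quadFeature, PiLp.inner_apply, Fin.sum_univ_three]
  simp
  field_simp

/-- Representer argument: projecting the coefficient vector onto the span of the training features
leaves its inner products with those features unchanged. -/
theorem exists_kernelScore_eq_quadratic_on {N : ℕ} (u : Fin N → (ZMod p)ˣ) (a b c : ℝ) :
    ∃ α : Fin N → ℝ, ∀ j, kernelScore g u α 0 (u j)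
      = a * projFeature g (u j) ^ 2 + b * projFeature g (u j) + c := by
  set φ : Fin N → EuclideanSpace ℝ (Fin 3) := fun i => quadFeature (projFeature g (u i)) with hφ
  set K := Submodule.span ℝ (Set.range φ) with hK
  set w : EuclideanSpace ℝ (Fin 3) := !₂[a, b / √2, c] with hw
  obtain ⟨α, hα⟩ := (Submodule.mem_span_range_iff_exists_fun ℝ).1 (K.orthogonalProjectionOnto w).2
  refine ⟨α, fun j => ?_⟩
  have hj : φ j ∈ K := Submodule.subset_span ⟨j, rfl⟩
  have h1 : inner ℝ (K.orthogonalProjectionOnto w : EuclideanSpace ℝ (Fin 3)) (φ j)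
      = inner ℝ w (φ j) := by
    have := K.inner_orthogonalProjectionOnto_eq_of_mem_left ⟨φ j, hj⟩ w
    rw [real_inner_comm, real_inner_comm (φ j) w]
    rwa [Submodule.coe_inner] at this
  rw [← inner_toLp_quadFeature, ← h1, ← hα, sum_inner]
  simp only [kernelScore, projKernel, add_zero, hφ, inner_smul_left, inner_quadFeature]
  simp

theorem exists_kernelScore_margin (hp : p ≠ 2)
    (hg : ∀ x : (ZMod p)ˣ, x ∈ Subgroup.zpowers g) (s N : ℕ) (u : Fin N → (ZMod p)ˣ) :
    ∃ α : Fin N → ℝ, ∀ j : Fin N,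
      1 ≤ (((dlogLabel g s (u j) : ℤˣ) : ℤ) : ℝ) * kernelScore g u α 0 (u j) := by
  obtain ⟨a, b, c, h⟩ := exists_quadratic_label_mul_pos hp hg s
  obtain ⟨x₀, hx₀⟩ := Finite.exists_min fun x : (ZMod p)ˣ => (((dlogLabel g s x : ℤˣ) : ℤ) : ℝ) *
      (a * projFeature g x ^ 2 + b * projFeature g x + c)
  -- The smallest margin over the finite group; dividing the quadratic by it makes every margin at
  -- least 1.
  set δ := (((dlogLabel g s x₀ : ℤˣ) : ℤ) : ℝ) *
      (a * projFeature g x₀ ^ 2 + b * projFeature g x₀ + c)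
  have hδ : 0 < δ := h x₀
  obtain ⟨α, hα⟩ := exists_kernelScore_eq_quadratic_on (g := g) u (a / δ) (b / δ) (c / δ)
  refine ⟨α, fun j => ?_⟩
  rw [hα, show (((dlogLabel g s (u j) : ℤˣ) : ℤ) : ℝ) * (a / δ * projFeature g (u j) ^ 2
    + b / δ * projFeature g (u j) + c / δ) = (((dlogLabel g s (u j) : ℤˣ) : ℤ) : ℝ) *
    (a * projFeature g (u j) ^ 2 + b * projFeature g (u j) + c) / δ by ring, le_div_iff₀ hδ,
    one_mul]
  exact hx₀ (u j)

end DiscreteLog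

/-! ### Sample complexity -/

theorem card_div_eq_le (q L j : ℕ) (hL : 0 < L) :
    ((Finset.range q).filter fun k => k / L = j).card ≤ L := by
  calc _ ≤ (Finset.Ico (j * L) (j * L + L)).card := by
        refine Finset.card_le_card fun k hk => ?_
        obtain ⟨-, hk⟩ := Finset.mem_filter.1 hk
        rw [Nat.div_eq_iff hL] at hk
        rw [Finset.mem_Ico]; omega
    _ = L := by simp

theorem card_div_eq (q L j : ℕ) (hL : 0 < L) (hj : j < q / L) :
    ((Finset.range q).filter fun k => k / L = j).card = L := by
  have h : ((Finset.range q).filter fun k => k / L = j) = Finset.Ico (j * L) (j * L + L) := by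
    ext k
    have h1 : (j + 1) * L ≤ q := (Nat.le_div_iff_mul_le hL).1 hj
    have h2 : (j + 1) * L = j * L + L := by ring
    rw [Finset.mem_filter, Finset.mem_range, Finset.mem_Ico, Nat.div_eq_iff hL]
    omega
  rw [h]; simp

theorem exists_root_of_sgn_ne {a b c x y : ℝ} (hxy : x ≤ y)
    (h : sgn (a * x ^ 2 + b * x + c) ≠ sgn (a * y ^ 2 + b * y + c)) :
    ∃ r ∈ Set.Icc x y, a * r ^ 2 + b * r + c = 0 := by
  have hc : ContinuousOn (fun z : ℝ => a * z ^ 2 + b * z + c) (Set.uIcc x y) := by fun_prop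
  have := intermediate_value_uIcc hc (a := x) (b := y)
  rw [Set.uIcc_of_le hxy] at this
  have h0 : (0 : ℝ) ∈ Set.uIcc (a * x ^ 2 + b * x + c) (a * y ^ 2 + b * y + c) := by
    rw [Set.mem_uIcc]
    unfold sgn at h
    split_ifs at h with h1 h2 h2
    · exact absurd rfl h
    · right; constructor <;> linarith
    · left; constructor <;> linarith
    · exact absurd rfl h
  obtain ⟨r, hr, hr0⟩ := this h0
  exact ⟨r, hr, hr0⟩

theorem exists_sign_change_points {h : ℝ → ℤˣ} (hh : h ∈ quadSignClass) :
    ∃ R : Finset ℝ, R.card ≤ 2 ∧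
      ∀ x y : ℝ, x ≤ y → h x ≠ h y → ∃ r ∈ R, r ∈ Set.Icc x y := by
  obtain ⟨a, b, c, rfl⟩ := hh
  set P : Polynomial ℝ := Polynomial.C a * Polynomial.X ^ 2 + Polynomial.C b * Polynomial.X
    + Polynomial.C c with hP
  have heval (z : ℝ) : P.eval z = a * z ^ 2 + b * z + c := by simp [hP]
  refine ⟨P.roots.toFinset, ?_, fun x y hxy hne => ?_⟩
  · exact (Multiset.toFinset_card_le _).trans
      ((Polynomial.card_roots' P).trans Polynomial.natDegree_quadratic_le)
  · obtain ⟨r, hr, hr0⟩ := exists_root_of_sgn_ne hxy hne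
    refine ⟨r, ?_, hr⟩
    rw [Multiset.mem_toFinset, Polynomial.mem_roots', Polynomial.IsRoot, heval]
    -- The zero polynomial has an empty root multiset, but its sign never changes.
    refine ⟨fun h0 => hne ?_, hr0⟩
    simp only [← heval, h0, Polynomial.eval_zero]

theorem exists_sign_change_points_of_ne {h h' : ℝ → ℤˣ} (hh : h ∈ quadSignClass)
    (hh' : h' ∈ quadSignClass) :
    ∃ R : Finset ℝ, R.card ≤ 4 ∧ ∀ x y : ℝ, h x ≠ h' x → h y = h' y →
      ∃ r ∈ R, r ∈ Set.uIcc x y := by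
  obtain ⟨R, hR, hRc⟩ := exists_sign_change_points hh
  obtain ⟨R', hR', hRc'⟩ := exists_sign_change_points hh'
  refine ⟨R ∪ R', (Finset.card_union_le _ _).trans (by omega), fun x y hx hy => ?_⟩
  have hor : h x ≠ h y ∨ h' x ≠ h' y := by
    by_contra! hcon
    exact hx (by rw [hcon.1, hcon.2, hy])
  rcases le_total x y with hxy | hxy
  · rw [Set.uIcc_of_le hxy]
    rcases hor with hne | hne
    · obtain ⟨r, hr, hm⟩ := hRc x y hxy hne
      exact ⟨r, Finset.mem_union_left _ hr, hm⟩
    · obtain ⟨r, hr, hm⟩ := hRc' x y hxy hne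
      exact ⟨r, Finset.mem_union_right _ hr, hm⟩
  · rw [Set.uIcc_of_ge hxy]
    rcases hor with hne | hne
    · obtain ⟨r, hr, hm⟩ := hRc y x hxy hne.symm
      exact ⟨r, Finset.mem_union_left _ hr, hm⟩
    · obtain ⟨r, hr, hm⟩ := hRc' y x hxy hne.symm
      exact ⟨r, Finset.mem_union_right _ hr, hm⟩

section Sampling

variable {p : ℕ} [Fact p.Prime] {g : (ZMod p)ˣ}

/-- If every full block of `L` consecutive exponents is hit by a sample point at which two sign
functions agree, then they disagree on few points. -/
theorem card_disagreement_le (hg : ∀ x : (ZMod p)ˣ, x ∈ Subgroup.zpowers g) {h h' : ℝ → ℤˣ}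
    (hh : h ∈ quadSignClass) (hh' : h' ∈ quadSignClass) {L : ℕ} (hL : 0 < L)
    (hit : ∀ j < (p - 1) / L, ∃ x : (ZMod p)ˣ, dlog g x / L = j ∧
      h (projFeature g x) = h' (projFeature g x)) :
    (Finset.univ.filter fun x : (ZMod p)ˣ =>
      h (projFeature g x) ≠ h' (projFeature g x)).card ≤ 5 * L := by
  obtain ⟨R, hR, hRc⟩ := exists_sign_change_points_of_ne hh hh'
  have hp0 := prime_cast_pos (p := p)
  have hblock (x : (ZMod p)ˣ) : ⌊projFeature g x * p⌋₊ / L = dlog g x / L := by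
    rw [projFeature, div_mul_cancel₀ _ hp0.ne', Nat.floor_natCast]
  -- The blocks of the at most four roots, plus the possibly incomplete last block, which need not
  -- be sampled.
  set J : Finset ℕ := insert ((p - 1) / L) (R.image fun r : ℝ => ⌊r * p⌋₊ / L) with hJ
  have hJc : J.card ≤ 5 :=
    (Finset.card_insert_le _ _).trans (Nat.succ_le_succ (Finset.card_image_le.trans hR))
  have hsub : (Finset.univ.filter fun x : (ZMod p)ˣ =>
      h (projFeature g x) ≠ h' (projFeature g x)) ⊆
      J.biUnion fun j => Finset.univ.filter fun x : (ZMod p)ˣ => dlog g x / L = j := by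
    intro x hx
    simp only [Finset.mem_filter, Finset.mem_univ, true_and] at hx
    simp only [Finset.mem_biUnion, Finset.mem_filter, Finset.mem_univ, true_and, exists_eq_right']
    rcases lt_or_ge (dlog g x / L) ((p - 1) / L) with hlt | hge
    · obtain ⟨y, hyb, hy⟩ := hit _ hlt
      obtain ⟨r, hr, hm⟩ := hRc _ _ hx hy
      refine Finset.mem_insert_of_mem (Finset.mem_image.2 ⟨r, hr, ?_⟩)
      -- The block index is monotone in z, so a root between two points of one block lies in that
      -- block.
      have hmono : Monotone fun z : ℝ => ⌊z * p⌋₊ / L := fun z w hzw =>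
        Nat.div_le_div_right (Nat.floor_le_floor (mul_le_mul_of_nonneg_right hzw hp0.le))
      have hm' := hmono.image_uIcc_subset (Set.mem_image_of_mem _ hm)
      simpa [hblock, hyb] using hm'
    · have := Nat.div_le_div_right (c := L) (dlog_lt hg x).le
      rw [le_antisymm this hge]
      exact Finset.mem_insert_self _ _
  calc _ ≤ _ := Finset.card_le_card hsub
    _ ≤ J.card * L := Finset.card_biUnion_le_card_mul _ _ _ fun j _ => by
        rw [card_filter_dlog hg (fun k => k / L = j)]
        exact card_div_eq_le _ _ _ hL
    _ ≤ 5 * L := Nat.mul_le_mul_right _ hJc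

theorem card_missing_block (hg : ∀ x : (ZMod p)ˣ, x ∈ Subgroup.zpowers g) {L j : ℕ}
    (hL : 0 < L) (hj : j < (p - 1) / L) (N : ℕ) :
    (Finset.univ.filter fun u : Fin N → (ZMod p)ˣ => ∀ i, dlog g (u i) / L ≠ j).card
      = (p - 1 - L) ^ N := by
  have h1 : (Finset.univ.filter fun u : Fin N → (ZMod p)ˣ => ∀ i, dlog g (u i) / L ≠ j)
      = Fintype.piFinset fun _ => Finset.univ.filter fun x => dlog g x / L ≠ j := by
    ext u; simp
  rw [h1, Fintype.card_piFinset_const, card_filter_dlog hg (fun k => k / L ≠ j)]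
  have h2 := Finset.card_filter_add_card_filter_not (s := Finset.range (p - 1))
    (fun k => k / L = j)
  rw [card_div_eq _ _ _ hL hj, Finset.card_range] at h2
  congr 1
  simp only [ne_eq]
  omega

theorem card_missing_some_block_le (hg : ∀ x : (ZMod p)ˣ, x ∈ Subgroup.zpowers g) {L : ℕ}
    (hL : 0 < L) (N : ℕ) :
    (Finset.univ.filter fun u : Fin N → (ZMod p)ˣ =>
      ¬ ∀ j < (p - 1) / L, ∃ i, dlog g (u i) / L = j).card
      ≤ (p - 1) / L * (p - 1 - L) ^ N := by
  have hsub : (Finset.univ.filter fun u : Fin N → (ZMod p)ˣ =>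
      ¬ ∀ j < (p - 1) / L, ∃ i, dlog g (u i) / L = j) ⊆
      (Finset.range ((p - 1) / L)).biUnion fun j =>
        Finset.univ.filter fun u : Fin N → (ZMod p)ˣ => ∀ i, dlog g (u i) / L ≠ j := by
    intro u hu
    simp only [Finset.mem_filter, Finset.mem_univ, true_and] at hu
    push Not at hu
    simpa using hu
  calc _ ≤ _ := Finset.card_le_card hsub
    _ ≤ (Finset.range ((p - 1) / L)).card * (p - 1 - L) ^ N :=
        Finset.card_biUnion_le_card_mul _ _ _ fun j hj =>
          (card_missing_block hg hL (Finset.mem_range.1 hj) N).le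
    _ = _ := by rw [Finset.card_range]

/-- The probability that `N` uniform samples hit every full block of `L` exponents. -/
theorem unifProb_hit_blocks (hg : ∀ x : (ZMod p)ˣ, x ∈ Subgroup.zpowers g) {L : ℕ}
    (hL : 0 < L) (hLp : L ≤ p - 1) (N : ℕ) :
    1 - ((p - 1 : ℕ) / L : ℝ) * (1 - L / (p - 1 : ℕ)) ^ N ≤
      unifProb {u : Fin N → (ZMod p)ˣ | ∀ j < (p - 1) / L, ∃ i, dlog g (u i) / L = j} := by
  classical
  have hcard : Fintype.card (Fin N → (ZMod p)ˣ) = (p - 1) ^ N := by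
    rw [Fintype.card_fun, Fintype.card_fin, ZMod.card_units]
  have hq : (0 : ℝ) < (p - 1 : ℕ) := by exact_mod_cast hL.trans_le hLp
  have hqN : (0 : ℝ) < ((p - 1 : ℕ) : ℝ) ^ N := by positivity
  rw [unifProb_eq, hcard, Nat.cast_pow, le_div_iff₀ hqN]
  have hsplit := Finset.card_filter_add_card_filter_not
    (s := (Finset.univ : Finset (Fin N → (ZMod p)ˣ)))
    (fun u => ∀ j < (p - 1) / L, ∃ i, dlog g (u i) / L = j)
  rw [Finset.card_univ, hcard] at hsplit
  have hbad := card_missing_some_block_le hg hL N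
  have hbad' : ((Finset.univ.filter fun u : Fin N → (ZMod p)ˣ =>
      ¬ ∀ j < (p - 1) / L, ∃ i, dlog g (u i) / L = j).card : ℝ) ≤
      ((p - 1 : ℕ) / L : ℝ) * ((p - 1 : ℕ) - L) ^ N := by
    refine (Nat.cast_le.2 hbad).trans ?_
    rw [Nat.cast_mul, Nat.cast_pow, Nat.cast_sub hLp]
    have : (0 : ℝ) ≤ (p - 1 : ℕ) - (L : ℝ) := sub_nonneg.2 (Nat.cast_le.2 hLp)
    gcongr
    exact Nat.cast_div_le
  have hsplit' : ((Finset.univ.filter fun u : Fin N → (ZMod p)ˣ =>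
      ∀ j < (p - 1) / L, ∃ i, dlog g (u i) / L = j).card : ℝ) +
      ((Finset.univ.filter fun u : Fin N → (ZMod p)ˣ =>
      ¬ ∀ j < (p - 1) / L, ∃ i, dlog g (u i) / L = j).card : ℝ) = ((p - 1 : ℕ) : ℝ) ^ N := by
    exact_mod_cast hsplit
  have hpow : (1 - (L : ℝ) / (p - 1 : ℕ)) ^ N * ((p - 1 : ℕ) : ℝ) ^ N
      = ((p - 1 : ℕ) - (L : ℝ)) ^ N := by
    rw [← mul_pow, sub_mul, one_mul, div_mul_cancel₀ _ hq.ne']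
  rw [sub_mul, one_mul, mul_assoc, hpow]
  simp only [Set.mem_ofPred_eq]
  linarith

end Sampling

/-- The sample size gives θN ≥ 11 log(1/ε), hence (1 - θ)^N ≤ ε¹¹. One factor ε cancels the 10/ε
from the number of blocks, and what is left, 10ε¹⁰, is at most 10/1024. -/
theorem block_failure_le {ε θ : ℝ} (hε : 0 < ε) (hε2 : ε ≤ 1 / 2) (hθ : ε / 10 ≤ θ) (hθ1 : θ ≤ 1)
    {N : ℕ} (hN : 100 * (Real.log (1 / ε) / ε ^ 2) ≤ N) :
    θ⁻¹ * (1 - θ) ^ N ≤ 1 / 100 := by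
  have hlog : 0 ≤ Real.log (1 / ε) := Real.log_nonneg (by rw [le_div_iff₀ hε]; linarith)
  have hexp : 11 * Real.log (1 / ε) ≤ θ * N := by
    calc 11 * Real.log (1 / ε) ≤ (10 / ε) * Real.log (1 / ε) := by
          refine mul_le_mul_of_nonneg_right ?_ hlog
          rw [le_div_iff₀ hε]; linarith
      _ = ε / 10 * (100 * (Real.log (1 / ε) / ε ^ 2)) := by field_simp; ring
      _ ≤ θ * N := mul_le_mul hθ hN (by positivity) (by linarith)
  have hpow : (1 - θ) ^ N ≤ ε ^ 11 := by
    calc (1 - θ) ^ N ≤ Real.exp (-θ) ^ N :=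
          pow_le_pow_left₀ (by linarith) (Real.one_sub_le_exp_neg θ) N
      _ = Real.exp (-(θ * N)) := by rw [← Real.exp_nat_mul]; ring_nf
      _ ≤ Real.exp ((11 : ℕ) * Real.log ε) := by
          refine Real.exp_le_exp.2 ?_
          rw [one_div, Real.log_inv] at hexp
          push_cast
          linarith
      _ = ε ^ 11 := by rw [Real.exp_nat_mul, Real.exp_log hε]
  have hinv : θ⁻¹ ≤ 10 / ε := by
    rw [← inv_div]; exact inv_anti₀ (by positivity) hθ
  calc θ⁻¹ * (1 - θ) ^ N ≤ 10 / ε * ε ^ 11 :=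
        mul_le_mul hinv hpow (pow_nonneg (by linarith) _) (by positivity)
    _ = 10 * ε ^ 10 := by field_simp
    _ ≤ 10 * (1 / 2) ^ 10 := by gcongr
    _ ≤ 1 / 100 := by norm_num

theorem unifProb_mono {Ω : Type*} [Fintype Ω] [Nonempty Ω] {E F : Set Ω} (h : E ⊆ F) :
    unifProb E ≤ unifProb F := by
  classical
  rw [unifProb_eq, unifProb_eq]
  gcongr

/-- A block length proportional to `ε q`, for which either blocks are single exponents or five
blocks have total length at most `ε q`. -/
theorem exists_block_length {ε : ℝ} (hε : 0 < ε) (hε2 : ε ≤ 1 / 2) {q : ℕ} (hq : 0 < q) :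
    ∃ L : ℕ, 0 < L ∧ L ≤ q ∧ ε / 10 * q ≤ L ∧ (L = 1 ∨ (5 * L : ℝ) ≤ ε * q) := by
  have hq' : (0 : ℝ) < q := by exact_mod_cast hq
  rcases lt_or_ge (ε * q / 5) 1 with h | h
  · refine ⟨1, one_pos, hq, ?_, Or.inl rfl⟩
    rw [Nat.cast_one]
    linarith
  · have h1 : 1 ≤ ⌊ε * q / 5⌋₊ := (Nat.one_le_floor_iff _).2 h
    have h2 : (⌊ε * q / 5⌋₊ : ℝ) ≤ ε * q / 5 := Nat.floor_le (by positivity)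
    have h3 := Nat.lt_floor_add_one (ε * q / 5)
    have h1' : (1 : ℝ) ≤ ⌊ε * q / 5⌋₊ := by exact_mod_cast h1
    -- A floor that is at least 1 is at least half of its argument, hence the constant ε/10.
    refine ⟨_, h1, ?_, by linarith, Or.inr (by linarith)⟩
    have : (⌊ε * q / 5⌋₊ : ℝ) ≤ q := by nlinarith
    exact_mod_cast this

theorem sample_complexity {p : ℕ} [Fact p.Prime] (hp : p ≠ 2) {g : (ZMod p)ˣ}
    (hg : ∀ x : (ZMod p)ˣ, x ∈ Subgroup.zpowers g) (s : ℕ) {ε : ℝ} (hε : 0 < ε)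
    (hε2 : ε ≤ 1 / 2) {N : ℕ} (hN : 100 * (Real.log (1 / ε) / ε ^ 2) ≤ N) :
    99 / 100 ≤ unifProb {u : Fin N → (ZMod p)ˣ |
      ∀ h ∈ quadSignClass,
        (∀ i : Fin N, h (projFeature g (u i)) = dlogLabel g s (u i)) →
        unifProb {x : (ZMod p)ˣ | h (projFeature g x) ≠ dlogLabel g s x} ≤ ε} := by
  classical
  have hq : 0 < p - 1 := Nat.sub_pos_of_lt (Fact.out : p.Prime).one_lt
  have hq' : (0 : ℝ) < (p - 1 : ℕ) := by exact_mod_cast hq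
  obtain ⟨L, hL, hLq, hεL, hL5⟩ := exists_block_length hε hε2 hq
  have hfail := block_failure_le hε hε2 (θ := L / (p - 1 : ℕ)) ((le_div_iff₀ hq').2 hεL)
    ((div_le_one hq').2 (Nat.cast_le.2 hLq)) hN
  rw [inv_div] at hfail
  have hhit := unifProb_hit_blocks hg hL hLq N
  refine (by linarith : (99 / 100 : ℝ) ≤ _).trans
    (hhit.trans (unifProb_mono fun u hu h hh hfit => ?_))
  obtain ⟨y, hy, hlab⟩ := exists_quadSignClass_eq_dlogLabel hp hg s
  simp only [hlab] at hfit ⊢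
  have hit (j : ℕ) (hj : j < (p - 1) / L) : ∃ x : (ZMod p)ˣ, dlog g x / L = j ∧
      h (projFeature g x) = y (projFeature g x) := by
    obtain ⟨i, hi⟩ := hu j hj
    exact ⟨u i, hi, hfit i⟩
  rw [unifProb_eq, ZMod.card_units, div_le_iff₀ hq']
  simp only [Set.mem_ofPred_eq]
  rcases hL5 with rfl | hL5
  -- Blocks of length 1: every group element has been sampled, so there is no error at all.
  · rw [Finset.filter_false_of_mem, Finset.card_empty, Nat.cast_zero]
    · positivity
    · intro x _ hx
      obtain ⟨x', hx', he⟩ := hit (dlog g x) (by simpa using dlog_lt hg x)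
      rw [Nat.div_one] at hx'
      exact hx (dlog_injective hg hx' ▸ he)
  · refine le_trans ?_ hL5
    exact_mod_cast card_disagreement_le hg hh hy hL hit

theorem mainTheorem5 :
    -- the signs of quadratics have VC dimension 3
    classVCDim quadSignClass = 3 ∧
    (∀ (p : ℕ) [Fact p.Prime], p ≠ 2 →
      ∀ g : (ZMod p)ˣ, (∀ x : (ZMod p)ˣ, x ∈ Subgroup.zpowers g) → ∀ s : ℕ,
        -- the labels are the sign of a quadratic in the projected feature
        (∃ h ∈ quadSignClass, ∀ x : (ZMod p)ˣ, dlogLabel g s x = h (projFeature g x)) ∧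
        -- the functions expressed by the projected quantum kernel are exactly the quadratics
        {f : (ZMod p)ˣ → ℝ | ∃ (M : ℕ) (u : Fin M → (ZMod p)ˣ) (α : Fin M → ℝ) (β : ℝ),
            f = kernelScore g u α β} =
          {f : (ZMod p)ˣ → ℝ | ∃ a b c : ℝ,
            f = fun x => a * projFeature g x ^ 2 + b * projFeature g x + c} ∧
        -- every training set is fitted perfectly, with margin, by a kernel machine that is
        -- centered at the training inputs and needs no bias
        (∀ (N : ℕ) (u : Fin N → (ZMod p)ˣ), ∃ α : Fin N → ℝ, ∀ j : Fin N,
          1 ≤ (((dlogLabel g s (u j) : ℤˣ) : ℤ) : ℝ) * kernelScore g u α 0 (u j))) ∧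
    -- sample complexity, with one constant for all primes, generators and offsets
    (∃ C : ℝ, 0 < C ∧
      ∀ (p : ℕ) [Fact p.Prime], p ≠ 2 →
      ∀ g : (ZMod p)ˣ, (∀ x : (ZMod p)ˣ, x ∈ Subgroup.zpowers g) → ∀ s : ℕ,
      ∀ ε : ℝ, 0 < ε → ε ≤ 1 / 2 →
      ∀ N : ℕ, C * (Real.log (1 / ε) / ε ^ 2) ≤ (N : ℝ) →
        99 / 100 ≤ unifProb {u : Fin N → (ZMod p)ˣ |
          ∀ h ∈ quadSignClass,
            (∀ i : Fin N, h (projFeature g (u i)) = dlogLabel g s (u i)) →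
            unifProb {x : (ZMod p)ˣ | h (projFeature g x) ≠ dlogLabel g s x} ≤ ε}) := by
  refine ⟨classVCDim_quadSignClass, ?_, 100, by norm_num, ?_⟩
  · intro p _ hp g hg s
    exact ⟨exists_quadSignClass_eq_dlogLabel hp hg s, kernel_functions_eq_quadratics hp hg,
      exists_kernelScore_margin hp hg s⟩
  · intro p _ hp g hg s ε hε hε2 N hN
    exact sample_complexity hp hg s hε hε2 hN
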